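/- Let $\mathcal K_m=\{x\in\mathbb R^m : x_1\ge\sqrt{x_2^2+\dots+x_m^2}\}$ be the second order cone ($m\ge 1$), let $K=K_1\times\dots\times K_t$ with $K_i=\mathcal K_{m_i}$, let $A$ be a real matrix with $n$ columns and $m_1+\dots+m_t$ rows, and let $b\in\mathbb R^{m_1}\times\dots\times\mathbb R^{m_t}$. Vectors of this space are written in blocks as $v=(v_1;\dots;v_t)$, $v_i\in\mathbb R^{m_i}$, and $v_{i,k}$ is the $k$-th component of $v_i$. Consider the system $P_{SO}=\{x\in\mathbb R^n : b-Ax\in K\}$. It is called well-behaved if, for every $c\in\mathbb R^n$ for which $\sup\{\langle c,x\rangle : x\in P_{SO}\}$ is finite, there is $y\in K^*$ with $A^*y=c$ for which $\langle b,y\rangle$ equals this supremum, where $K^*=\{y : \langle y,x\rangle\ge 0\ \text{for all } x\in K\}$; otherwise it is called badly behaved. A maximum slack is a vector in the relative interior of $\{z\in K : z=b-Ax \text{ for some } x\in\mathbb R^n\}$. Suppose that $z$ is a maximum slack each of whose blocks $z_i$ is $0$, $(1;e_1)=(1,1,0,\dots,0)^T$ (where $m_i\ge 2$), or $e_1=(1,0,\dots,0)^T$,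 and let $O$, $R$, $I$ be the sets of the indices $i$ for which $z_i=0$, $z_i=(1;e_1)$, $z_i=e_1$, respectively. Call a block-diagonal matrix $T$ with blocks $T_1,\dots,T_t$ admissible if every $T_i$ is a symmetric $m_i\times m_i$ matrix with $T_iK_i=K_i$, and $Tz=z$. **Theorem 4.1.** The system $P_{SO}$ is badly behaved if and only if, after replacing $A$ and $b$ by $TA$ and $Tb$ for some admissible $T$, there is a vector $v=(v_1;\dots;v_t)$ which is a linear combination of the columns of $A$ and of $b$ and satisfies - $v_i\in K_i$ for all $i\in O$; - $v_{i,1}\ge v_{i,2}$ for all $i\in R$; - for some $j\in R$ (with $m_j\ge 3$) and some real number $\alpha$, $v_j=(\alpha,\alpha,1,\dots)^T$, where the dots denote arbitrary components. -/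

import Mathlib

/-! ### General conic linear systems -/

namespace ConicSystem

variable {X Y : Type*}
  [NormedAddCommGroup X] [InnerProductSpace ℝ X] [FiniteDimensional ℝ X]
  [NormedAddCommGroup Y] [InnerProductSpace ℝ Y] [FiniteDimensional ℝ Y] [CompleteSpace Y]

/-- The feasible set `P = {x | A x ≤_K b}`, where `s ≤_K t` means `t - s ∈ K`. -/
def feasibleSet (A : X →ₗ[ℝ] Y) (b : Y) (K : ProperCone ℝ Y) : Set X :=
  {x | b - A x ∈ K}

/-- The value of `sup ⟨c, x⟩` subject to `A x ≤_K b`, as an extended real number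
(it is `⊥` if the system is infeasible, and `⊤` if the objective is unbounded). -/
noncomputable def primalValue (A : X →ₗ[ℝ] Y) (b : Y) (K : ProperCone ℝ Y) (c : X) : EReal :=
  ⨆ x ∈ feasibleSet A b K, ((inner ℝ c x : ℝ) : EReal)

/-- The feasible set of the dual problem `inf ⟨b, y⟩` subject to `y ∈ K*`, `A* y = c`. -/
noncomputable def dualFeasibleSet (A : X →ₗ[ℝ] Y) (K : ProperCone ℝ Y) (c : X) : Set Y :=
  {y | y ∈ ProperCone.innerDual (K : Set Y) ∧ LinearMap.adjoint A y = c}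

/-- The system is well-behaved if, for every objective function `c` for which the primal value
is finite, the dual has a feasible solution which attains the same value. -/
def WellBehaved (A : X →ₗ[ℝ] Y) (b : Y) (K : ProperCone ℝ Y) : Prop :=
  ∀ (c : X) (r : ℝ), primalValue A b K c = (r : EReal) →
    ∃ y ∈ dualFeasibleSet A K c, inner ℝ b y = r

/-- The system is badly behaved if it is not well-behaved. -/
def BadlyBehaved (A : X →ₗ[ℝ] Y) (b : Y) (K : ProperCone ℝ Y) : Prop :=
  ¬ WellBehaved A b K

/-- A maximum slack is a vector in the relative interior of `{z | z = b - A x, z ∈ K}`. -/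
def IsMaximumSlack (A : X →ₗ[ℝ] Y) (b : Y) (K : ProperCone ℝ Y) (z : Y) : Prop :=
  z ∈ intrinsicInterior ℝ {s : Y | (∃ x : X, s = b - A x) ∧ s ∈ K}

end ConicSystem

/-! ### Second order cones and their products

Components are numbered from `0` here, so the first, second and third components of a vector are
those with index `0`, `1`, `2`. -/

namespace SOCP

/-- The second order cone `{x ∈ ℝᵐ | x₁ ≥ √(x₂² + ⋯ + xₘ²)}`, for `m ≥ 1`. -/
def soc (m : ℕ) [NeZero m] : ProperCone ℝ (EuclideanSpace ℝ (Fin m)) where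
  carrier := {x | √(∑ k ∈ Finset.univ.erase 0, x k ^ 2) ≤ x 0}
  add_mem' := by
    intro x y hx hy
    have key : ∀ w : EuclideanSpace ℝ (Fin m), √(∑ k ∈ Finset.univ.erase 0, w k ^ 2) =
        ‖(WithLp.toLp 2 (fun k : (Finset.univ.erase (0 : Fin m)) => w k) :
          EuclideanSpace ℝ (Finset.univ.erase (0 : Fin m)))‖ := by
      intro w
      rw [EuclideanSpace.norm_eq, ← Finset.sum_coe_sort]
      simp
    simp only [Set.mem_ofPred_eq, key] at hx hy ⊢
    exact (norm_add_le _ _).trans (add_le_add hx hy)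
  zero_mem' := by simp
  smul_mem' := by
    intro c x hx
    obtain ⟨c, hc⟩ := c
    simp only [Set.mem_ofPred_eq] at hx ⊢
    have h : ∀ k, ((⟨c, hc⟩ : NNReal) • x) k = c * x k := fun k => rfl
    simp only [h, mul_pow, ← Finset.mul_sum]
    rw [Real.sqrt_mul (sq_nonneg c), Real.sqrt_sq hc]
    exact mul_le_mul_of_nonneg_left hx hc
  isClosed' := by
    apply isClosed_le <;> fun_prop

variable {t : ℕ} {m : Fin t → ℕ}

/-- The `i`-th block `vᵢ ∈ ℝ^{mᵢ}` of `v = (v₁; …; v_t) ∈ ℝ^{m₁} × ⋯ × ℝ^{m_t}`. -/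
def block (v : EuclideanSpace ℝ (Σ i, Fin (m i))) (i : Fin t) : EuclideanSpace ℝ (Fin (m i)) :=
  WithLp.toLp 2 fun k => v ⟨i, k⟩

/-- The product cone `K = K₁ × ⋯ × K_t`, where `Kᵢ` is the second order cone in `ℝ^{mᵢ}`. -/
def socProd (m : Fin t → ℕ) [∀ i, NeZero (m i)] :
    ProperCone ℝ (EuclideanSpace ℝ (Σ i, Fin (m i))) where
  carrier := {v | ∀ i, block v i ∈ soc (m i)}
  add_mem' := by
    intro x y hx hy i
    have h : block (x + y) i = block x i + block y i := by ext k; simp [block]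
    rw [h]
    exact (soc (m i)).toSubmodule.add_mem (hx i) (hy i)
  zero_mem' := by
    intro i
    have h : block (0 : EuclideanSpace ℝ (Σ i, Fin (m i))) i = 0 := by ext k; simp [block]
    rw [h]
    exact (soc (m i)).toSubmodule.zero_mem
  smul_mem' := by
    intro c x hx i
    have h : block (c • x) i = c • block x i := by ext k; rfl
    rw [h]
    exact (soc (m i)).toSubmodule.smul_mem c (hx i)
  isClosed' := by
    have h : {v : EuclideanSpace ℝ (Σ i, Fin (m i)) | ∀ i, block v i ∈ soc (m i)} =
        ⋂ i, (fun v => block v i) ⁻¹' (soc (m i) : Set (EuclideanSpace ℝ (Fin (m i)))) := by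
      ext v
      simp
    change IsClosed {v : EuclideanSpace ℝ (Σ i, Fin (m i)) | ∀ i, block v i ∈ soc (m i)}
    rw [h]
    refine isClosed_iInter fun i => (soc (m i)).isClosed.preimage ?_
    unfold block
    fun_prop

/-- The linear combinations of the columns of `A` and of `b`. -/
def columnSpan {n : ℕ} (A : Matrix (Σ i, Fin (m i)) (Fin n) ℝ)
    (b : EuclideanSpace ℝ (Σ i, Fin (m i))) :
    Submodule ℝ (EuclideanSpace ℝ (Σ i, Fin (m i))) :=
  Submodule.span ℝ (insert b (Set.range fun j => WithLp.toLp 2 (A.col j)))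

variable [∀ i, NeZero (m i)]

/-- `O`: the blocks in which `z` is zero. -/
def indexO (z : EuclideanSpace ℝ (Σ i, Fin (m i))) : Set (Fin t) :=
  {i | block z i = 0}

/-- `R`: the blocks in which `z` is `(1; e₁) = (1, 1, 0, …, 0)`. -/
def indexR (z : EuclideanSpace ℝ (Σ i, Fin (m i))) : Set (Fin t) :=
  {i | ∃ h : 2 ≤ m i,
    block z i = EuclideanSpace.single 0 1 + EuclideanSpace.single ⟨1, h⟩ 1}

/-- `I`: the blocks in which `z` is `e₁ = (1, 0, …, 0)`. -/
def indexI (z : EuclideanSpace ℝ (Σ i, Fin (m i))) : Set (Fin t) :=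
  {i | block z i = EuclideanSpace.single 0 1}

/-- Every block of `z` is `0`, `(1; e₁)` or `e₁`. -/
def IsNormalized (z : EuclideanSpace ℝ (Σ i, Fin (m i))) : Prop :=
  ∀ i, i ∈ indexO z ∨ i ∈ indexR z ∨ i ∈ indexI z

/-- The three conditions on `v`: `vᵢ ∈ Kᵢ` for `i ∈ O`, `v_{i,1} ≥ v_{i,2}` for `i ∈ R`, and
`vⱼ = (α, α, 1, …)` for some `j ∈ R` and some real `α`. -/
structure IsCertificate (z v : EuclideanSpace ℝ (Σ i, Fin (m i))) : Prop where
  mem_cone : ∀ i ∈ indexO z, block v i ∈ soc (m i)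
  second_le_first : ∀ i ∈ indexR z, ∀ h : 2 ≤ m i, block v i ⟨1, h⟩ ≤ block v i 0
  exists_form : ∃ j ∈ indexR z, ∃ h : 3 ≤ m j, ∃ α : ℝ,
    block v j 0 = α ∧ block v j ⟨1, by omega⟩ = α ∧ block v j ⟨2, h⟩ = 1

/-- The diagonal blocks `T₁, …, T_t` of an admissible transformation for `z`: each `Tᵢ` is a
symmetric matrix with `Tᵢ Kᵢ = Kᵢ`, and the block-diagonal matrix `T` keeps the normalized
slack, i.e. `T z = z`. -/
structure IsAdmissible (T : ∀ i, Matrix (Fin (m i)) (Fin (m i)) ℝ)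
    (z : EuclideanSpace ℝ (Σ i, Fin (m i))) : Prop where
  symm : ∀ i, (T i).IsSymm
  image_cone : ∀ i, Matrix.toEuclideanLin (T i) ''
    (soc (m i) : Set (EuclideanSpace ℝ (Fin (m i)))) = soc (m i)
  fix_slack : Matrix.toEuclideanLin (Matrix.blockDiagonal' T) z = z

end SOCP

/-! Write dir for the cone of feasible directions of `K` at `z` and tan for its closure
(`feasibleDir`, `tangentDir`). The core is the criterion `badlyBehaved_iff_exists_mem_tangentDir`:
the system is badly behaved exactly when some `A x` lies in tan but not in dir. As `z` is a maximum
slack, `L = {x | A x ∈ dir}` is a linear subspace.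

If such an `x` exists, every `c ∈ Lᗮ` is constant on the feasible set. A dual solution with the same
value would lie in the face of the dual cone conjugate to `z` and give `⟨c, x⟩ ≥ 0`. Applied to `c`
and `-c`, this puts `x` in `Lᗮᗮ = L`, a contradiction.

If no such `x` exists, the adjoint of `A` maps the conjugate face onto `Lᗮ`: the dual cone of the
image is the subspace `L`, and a convex cone whose dual is a subspace is itself a subspace, with no
closedness assumed. An objective with finite value is first represented on `L` only, by M. Riesz
extension over a cone larger than `K` for which `z` satisfies a Slater-type condition. The error
lies in `Lᗮ` and is corrected by an element of the conjugate face, which costs nothing since that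
face is orthogonal to `z`.

For a product of second order cones, tan and dir differ only over `R`: tan requires `v₁ ≥ v₂`, while
dir requires in addition that `v₁ = v₂` forces all later components to vanish. A bad direction thus
has a nonzero later component in some block with `v₁ = v₂`. A signed transposition and a positive
scaling turn it into the third component, with value 1. Admissible maps and multiples of `z` affect
neither cone, which gives the converse. -/

/-! ### Separation in inner product spaces -/

namespace ConicSystem

open Set Filter Topology

section Separation

variable {E V : Type*} [NormedAddCommGroup E] [InnerProductSpace ℝ E] [FiniteDimensional ℝ E]
  [AddCommGroup V] [Module ℝ V]

/-- M. Riesz extension for a functional given on the range of a linear map. -/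
theorem exists_inner_eq_of_nonneg (s : PointedCone ℝ E) (M : V →ₗ[ℝ] E) (φ : V →ₗ[ℝ] ℝ)
    (nonneg : ∀ v, M v ∈ s → 0 ≤ φ v) (dense : ∀ y, ∃ v, M v + y ∈ s) :
    ∃ u : E, (∀ v, inner ℝ u (M v) = φ v) ∧ ∀ x ∈ s, 0 ≤ inner ℝ u x := by
  -- `φ` factors through the range of `M`: if `M v = 0`, then `nonneg` applies to both `v` and `-v`.
  have hker : φ ∈ M.dualMap.range := by
    rw [LinearMap.range_dualMap_eq_dualAnnihilator_ker, Submodule.mem_dualAnnihilator]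
    intro v hv
    rw [LinearMap.mem_ker] at hv
    have h1 := nonneg v (by rw [hv]; exact s.zero_mem)
    have h2 := nonneg (-v) (by rw [map_neg, hv, neg_zero]; exact s.zero_mem)
    rw [map_neg] at h2
    linarith
  obtain ⟨ψ, hψ⟩ := hker
  have hψ' : ∀ v, ψ (M v) = φ v := fun v => by rw [← hψ]; rfl
  obtain ⟨g, hg, hgs⟩ := riesz_extension s ⟨LinearMap.range M, ψ.domRestrict _⟩
    (by
      rintro ⟨x, v, rfl⟩ hx
      change 0 ≤ ψ (M v)
      rw [hψ']
      exact nonneg v hx)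
    (fun y => by
      obtain ⟨v, hv⟩ := dense y
      exact ⟨⟨M v, v, rfl⟩, hv⟩)
  have : CompleteSpace E := FiniteDimensional.complete ℝ E
  refine ⟨(InnerProductSpace.toDual ℝ E).symm (LinearMap.toContinuousLinearMap g), ?_, ?_⟩
  · intro v
    rw [InnerProductSpace.toDual_symm_apply]
    exact (hg ⟨M v, v, rfl⟩).trans (hψ' v)
  · intro x hx
    rw [InnerProductSpace.toDual_symm_apply]
    exact hgs x hx

/-- A convex cone in a finite dimensional space is a subspace as soon as its dual cone is its
orthogonal complement. -/
theorem neg_mem_of_forall_inner_eq_zero (C : PointedCone ℝ E)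
    (h : ∀ x, (∀ c ∈ C, 0 ≤ inner ℝ x c) → ∀ c ∈ C, inner ℝ x c = 0) {c : E} (hc : c ∈ C) :
    -c ∈ C := by
  have hsmul : ∀ {a : ℝ} {x : E}, 0 ≤ a → x ∈ C → a • x ∈ C := fun ha hx =>
    PointedCone.smul_mem C ha hx
  let N : Submodule ℝ E := Submodule.span ℝ (C : Set E)
  classical
  obtain ⟨S, hSC, hS⟩ := (Submodule.fg_span_iff_fg_span_finset_subset (R := ℝ) (C : Set E)).1
    (IsNoetherian.noetherian _)
  -- The sum of a finite spanning subset of `C` is an order unit of `N`: by `key`, a multiple of `p`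
  -- absorbs every `y ∈ N` with either sign.
  let p : E := ∑ x ∈ S, x
  have hp : p ∈ C := C.sum_mem fun x hx => hSC hx
  have key : ∀ y ∈ N, (∃ l : ℝ, l • p + y ∈ C) ∧ ∃ l : ℝ, l • p - y ∈ C := by
    intro y hy
    change y ∈ Submodule.span ℝ (C : Set E) at hy
    rw [hS] at hy
    induction hy using Submodule.span_induction with
    | mem x hx =>
      refine ⟨⟨0, by simpa using hSC hx⟩, 1, ?_⟩
      have : (1 : ℝ) • p - x = ∑ y ∈ S.erase x, y := by
        rw [one_smul, sub_eq_iff_eq_add]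
        exact (Finset.sum_erase_add _ _ hx).symm
      rw [this]
      exact C.sum_mem fun y hy => hSC (Finset.mem_of_mem_erase hy)
    | zero => exact ⟨⟨0, by simp⟩, 0, by simp⟩
    | add x y _ _ hx hy =>
      obtain ⟨⟨a, ha⟩, b, hb⟩ := hx
      obtain ⟨⟨a', ha'⟩, b', hb'⟩ := hy
      refine ⟨⟨a + a', ?_⟩, b + b', ?_⟩
      · convert C.add_mem ha ha' using 1; module
      · convert C.add_mem hb hb' using 1; module
    | smul r x _ hx =>
      obtain ⟨⟨a, ha⟩, b, hb⟩ := hx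
      rcases le_total 0 r with hr | hr
      · refine ⟨⟨r * a, ?_⟩, r * b, ?_⟩
        · convert hsmul hr ha using 1; module
        · convert hsmul hr hb using 1; module
      · refine ⟨⟨-r * b, ?_⟩, -r * a, ?_⟩
        · convert hsmul (neg_nonneg.2 hr) hb using 1; module
        · convert hsmul (neg_nonneg.2 hr) ha using 1; module
  -- Otherwise `l • p ↦ l` is nonnegative where the line meets `C + Nᗮ`, and its extension `u` is
  -- nonnegative on `C` with `⟨u, p⟩ = 1`, against `h`. The summand `Nᗮ` makes `p` absorb all of
  -- `E`.
  have hpn : -p ∈ C := by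
    by_contra hpn
    obtain ⟨u, hu, hus⟩ := exists_inner_eq_of_nonneg
      (C ⊔ (Nᗮ).restrictScalars {r : ℝ // 0 ≤ r}) (LinearMap.toSpanSingleton ℝ E p) LinearMap.id
      (by
        intro l hl
        obtain ⟨c, hc, w, hw, hcw⟩ := Submodule.mem_sup.1 hl
        rw [LinearMap.toSpanSingleton_apply] at hcw
        have hw' : w ∈ Nᗮ := hw
        have hwN : w ∈ N := by
          rw [eq_sub_of_add_eq' hcw]
          exact N.sub_mem (N.smul_mem _ (Submodule.subset_span hp)) (Submodule.subset_span hc)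
        have hw0 : w = 0 := inner_self_eq_zero.1 ((Submodule.mem_orthogonal _ _).1 hw' w hwN)
        by_contra hneg
        have hneg' : l < 0 := not_le.1 hneg
        apply hpn
        have : -p = (-l)⁻¹ • c := by
          rw [hw0, add_zero] at hcw
          rw [hcw, smul_smul, inv_neg, neg_mul, inv_mul_cancel₀ hneg'.ne, neg_one_smul]
        rw [this]
        exact hsmul (inv_nonneg.2 (by linarith)) hc)
      (by
        intro y
        obtain ⟨n, hn, w, hw, rfl⟩ := Submodule.exists_add_mem_mem_orthogonal (K := N) y
        obtain ⟨l, hl⟩ := (key n hn).1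
        refine ⟨l, ?_⟩
        rw [LinearMap.toSpanSingleton_apply, ← add_assoc]
        exact Submodule.add_mem_sup hl hw)
    have h0 := h u (fun c hc => hus c (Submodule.mem_sup_left hc)) p hp
    have h1 := hu 1
    rw [LinearMap.toSpanSingleton_apply, one_smul, h0] at h1
    simp at h1
  obtain ⟨l, hl⟩ := (key c (Submodule.subset_span hc)).2
  have hlp : -(l • p) ∈ C := by
    rcases le_total 0 l with h | h
    · rw [← smul_neg]; exact hsmul h hpn
    · rw [← neg_smul]; exact hsmul (neg_nonneg.2 h) hp
  convert C.add_mem hl hlp using 1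
  abel

end Separation

/-! ### Feasible directions at a slack -/

section Directions

variable {Y : Type*} [NormedAddCommGroup Y] [InnerProductSpace ℝ Y]

/-- The cone of feasible directions at `z` in `K`. -/
def feasibleDir (K : ProperCone ℝ Y) (z : Y) : Set Y :=
  {v | ∃ ε : ℝ, 0 < ε ∧ z + ε • v ∈ K}

/-- The dual of the face of the dual cone which is conjugate to `z`. For `z ∈ K` it is the closure
of the cone of feasible directions at `z`. -/
def tangentDir (K : ProperCone ℝ Y) (z : Y) : Set Y :=
  {v | ∀ w : Y, (∀ x ∈ K, 0 ≤ inner ℝ x w) → inner ℝ z w = 0 → 0 ≤ inner ℝ v w}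

variable {K : ProperCone ℝ Y} {z u v : Y}

theorem smul_mem_cone {a : ℝ} (ha : 0 ≤ a) (hv : v ∈ K) : a • v ∈ K :=
  K.toSubmodule.smul_mem (⟨a, ha⟩ : {r : ℝ // 0 ≤ r}) hv

theorem add_mem_cone (hu : u ∈ K) (hv : v ∈ K) : u + v ∈ K :=
  K.toSubmodule.add_mem hu hv

theorem zero_mem_cone : (0 : Y) ∈ K := K.toSubmodule.zero_mem

/-- For this step length, the point reached along `u + v` is a convex combination of `z + ε • u` and
`z + δ • v`. -/
theorem add_mem_feasibleDir (hu : u ∈ feasibleDir K z) (hv : v ∈ feasibleDir K z) :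
    u + v ∈ feasibleDir K z := by
  obtain ⟨ε, hε, hu⟩ := hu
  obtain ⟨δ, hδ, hv⟩ := hv
  refine ⟨ε * δ / (ε + δ), by positivity, ?_⟩
  convert add_mem_cone (smul_mem_cone (a := δ / (ε + δ)) (by positivity) hu)
    (smul_mem_cone (a := ε / (ε + δ)) (by positivity) hv) using 1
  have h : z = (δ / (ε + δ) + ε / (ε + δ)) • z := by
    rw [← add_div, add_comm δ, div_self (by positivity), one_smul]
  nth_rw 1 [h]
  simp only [smul_add, smul_smul, add_smul]
  ring_nf
  abel

theorem smul_mem_feasibleDir {a : ℝ} (ha : 0 < a) (hv : v ∈ feasibleDir K z) :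
    a • v ∈ feasibleDir K z := by
  obtain ⟨ε, hε, hv⟩ := hv
  refine ⟨ε / a, by positivity, ?_⟩
  rwa [smul_smul, div_mul_cancel₀ _ ha.ne']

theorem mem_feasibleDir_of_mem (hz : z ∈ K) (hv : v ∈ K) : v ∈ feasibleDir K z :=
  ⟨1, one_pos, by rw [one_smul]; exact add_mem_cone hz hv⟩

theorem smul_self_mem_feasibleDir (hz : z ∈ K) (a : ℝ) : a • z ∈ feasibleDir K z := by
  refine ⟨(1 + |a|)⁻¹, by positivity, ?_⟩
  have h : z + (1 + |a|)⁻¹ • a • z = ((1 + |a|)⁻¹ * (1 + |a| + a)) • z := by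
    have : (1 + |a|)⁻¹ * (1 + |a| + a) = 1 + (1 + |a|)⁻¹ * a := by
      rw [mul_add, inv_mul_cancel₀ (by positivity)]
    rw [this, add_smul, one_smul, mul_smul]
  rw [h]
  have := neg_abs_le a
  exact smul_mem_cone (mul_nonneg (by positivity) (by linarith)) hz

/-- Both `z` and `-z` are feasible directions, so multiples of `z` are immaterial. This later allows
`b` in the column span to be traded for `z`. -/
theorem add_smul_self_mem_feasibleDir_iff (hz : z ∈ K) (a : ℝ) :
    v + a • z ∈ feasibleDir K z ↔ v ∈ feasibleDir K z := by
  refine ⟨fun h => ?_, fun h => add_mem_feasibleDir h (smul_self_mem_feasibleDir hz a)⟩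
  simpa using add_mem_feasibleDir h (smul_self_mem_feasibleDir hz (-a))

theorem add_smul_self_mem_tangentDir_iff (a : ℝ) :
    v + a • z ∈ tangentDir K z ↔ v ∈ tangentDir K z := by
  refine forall₃_congr fun w _ hw => ?_
  rw [inner_add_left, real_inner_smul_left, hw, mul_zero, add_zero]

end Directions

/-! ### Badly behaved systems -/

section BadlyBehaved

variable {X Y : Type*}
  [NormedAddCommGroup X] [InnerProductSpace ℝ X] [FiniteDimensional ℝ X]
  [NormedAddCommGroup Y] [InnerProductSpace ℝ Y] [FiniteDimensional ℝ Y] [CompleteSpace Y]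
  {A : X →ₗ[ℝ] Y} {b z : Y} {K : ProperCone ℝ Y}

theorem IsMaximumSlack.mem (hz : IsMaximumSlack A b K z) : (∃ x, z = b - A x) ∧ z ∈ K :=
  intrinsicInterior_subset (𝕜 := ℝ) (s := {s : Y | (∃ x : X, s = b - A x) ∧ s ∈ K}) hz

/-- A maximum slack can be moved backwards along every feasible direction. -/
theorem IsMaximumSlack.neg_mem_feasibleDir (hz : IsMaximumSlack A b K z) {x : X}
    (hx : A x ∈ feasibleDir K z) : -A x ∈ feasibleDir K z := by
  obtain ⟨⟨x₀, hx₀⟩, hzK⟩ := hz.mem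
  obtain ⟨ε, hε, hεx⟩ := hx
  let S : Set Y := {s : Y | (∃ x : X, s = b - A x) ∧ s ∈ K}
  have hzS : z ∈ S := ⟨⟨x₀, hx₀⟩, hzK⟩
  have hsS : z + ε • A x ∈ S := ⟨⟨x₀ - ε • x, by rw [hx₀, map_sub, map_smul]; abel⟩, hεx⟩
  have hline : ∀ r : ℝ, z + r • A x ∈ affineSpan ℝ S := by
    intro r
    have := AffineMap.lineMap_mem (r / ε) (mem_affineSpan ℝ hzS) (mem_affineSpan ℝ hsS)
    convert this using 1
    rw [AffineMap.lineMap_apply_module', add_sub_cancel_left, smul_smul,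
      div_mul_cancel₀ _ hε.ne', add_comm]
  obtain ⟨y, hy, hyz⟩ := mem_intrinsicInterior.1 hz
  let l : ℝ → affineSpan ℝ S := fun r => ⟨z + r • A x, hline r⟩
  have hl : Continuous l := Continuous.subtype_mk (by fun_prop) _
  have hl0 : l 0 = y := Subtype.ext (by simp [l, hyz])
  -- The whole line lies in the affine span, so relative interiority of `z` keeps it in `S` for
  -- small `r` of either sign.
  have hev : ∀ᶠ r in 𝓝 (0 : ℝ), z + r • A x ∈ S := by
    have := hl.continuousAt (x := 0) (by rw [hl0]; exact mem_interior_iff_mem_nhds.1 hy)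
    exact this
  obtain ⟨δ, hδ, hball⟩ := Metric.eventually_nhds_iff.1 hev
  have := hball (y := -(δ / 2)) (by rw [Real.dist_eq, sub_zero, abs_neg, abs_of_pos] <;> linarith)
  refine ⟨δ / 2, by linarith, ?_⟩
  rw [smul_neg, ← neg_smul]
  exact this.2

/-- The subspace of those `x` for which `A x` is a feasible direction at the maximum slack. -/
def feasibleDirSubmodule (hz : IsMaximumSlack A b K z) : Submodule ℝ X where
  carrier := {x | A x ∈ feasibleDir K z}
  add_mem' hx hy := by
    rw [mem_ofPred_eq, map_add]
    exact add_mem_feasibleDir hx hy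
  zero_mem' := by
    rw [mem_ofPred_eq, map_zero]
    exact mem_feasibleDir_of_mem hz.mem.2 zero_mem_cone
  smul_mem' a x hx := by
    rw [mem_ofPred_eq] at *
    rcases lt_trichotomy a 0 with ha | rfl | ha
    · have := smul_mem_feasibleDir (neg_pos.2 ha) (hz.neg_mem_feasibleDir hx)
      rwa [smul_neg, neg_smul, neg_neg, ← map_smul] at this
    · rw [zero_smul, map_zero]
      exact mem_feasibleDir_of_mem hz.mem.2 zero_mem_cone
    · rw [map_smul]
      exact smul_mem_feasibleDir ha hx

/-- For `c ∈ Lᗮ` the primal value is `⟨c, x₀⟩`. A dual `y` attaining it satisfies `⟨z, y⟩ = ⟨b, y⟩ -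
⟨c, x₀⟩ = 0`, so tangency gives `⟨c, x⟩ = ⟨y, A x⟩ ≥ 0`. -/
theorem IsMaximumSlack.badlyBehaved_of_mem_tangentDir (hz : IsMaximumSlack A b K z) {x : X}
    (hx : A x ∈ tangentDir K z) (hx' : A x ∉ feasibleDir K z) : BadlyBehaved A b K := by
  intro hwell
  apply hx'
  obtain ⟨⟨x₀, hx₀⟩, hzK⟩ := hz.mem
  let L := feasibleDirSubmodule hz
  have hnonneg : ∀ c ∈ Lᗮ, 0 ≤ inner ℝ c x := by
    intro c hc
    have hval : primalValue A b K c = ((inner ℝ c x₀ : ℝ) : EReal) := by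
      have hconst : ∀ y ∈ feasibleSet A b K, inner ℝ c y = inner ℝ c x₀ := by
        intro y hy
        have hmem : x₀ - y ∈ L := by
          refine ⟨1, one_pos, ?_⟩
          have : z + (1 : ℝ) • A (x₀ - y) = b - A y := by
            rw [hx₀, one_smul, map_sub]; abel
          rw [this]
          exact hy
        have := (Submodule.mem_orthogonal' _ _).1 hc _ hmem
        rw [inner_sub_right] at this
        linarith
      refine le_antisymm (iSup₂_le fun y hy => by rw [hconst y hy]) ?_
      refine le_iSup₂ (f := fun y (_ : y ∈ feasibleSet A b K) => ((inner ℝ c y : ℝ) : EReal)) x₀ ?_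
      change b - A x₀ ∈ K
      rwa [← hx₀]
    obtain ⟨y, ⟨hyK, hyc⟩, hyr⟩ := hwell c _ hval
    rw [ProperCone.mem_innerDual] at hyK
    have := hx y (fun k hk => hyK hk) (by
      rw [hx₀, inner_sub_left, hyr, ← LinearMap.adjoint_inner_right, hyc, real_inner_comm, sub_self])
    rwa [← LinearMap.adjoint_inner_right, hyc, real_inner_comm] at this
  have : x ∈ Lᗮᗮ := by
    rw [Submodule.mem_orthogonal]
    intro c hc
    have h1 := hnonneg c hc
    have h2 := hnonneg (-c) (Lᗮ.neg_mem hc)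
    rw [inner_neg_left] at h2
    linarith
  rwa [Submodule.orthogonal_orthogonal] at this

/-- If every tangent direction in the range of `A` is feasible, then each functional vanishing on
the feasible directions comes from the face of the dual cone conjugate to `z`. -/
theorem exists_adjoint_eq_of_mem_orthogonal (hz : IsMaximumSlack A b K z)
    (h : ∀ x, A x ∈ tangentDir K z → A x ∈ feasibleDir K z) {d : X}
    (hd : d ∈ (feasibleDirSubmodule hz)ᗮ) :
    ∃ w : Y, (∀ x ∈ K, 0 ≤ inner ℝ x w) ∧ inner ℝ z w = 0 ∧ LinearMap.adjoint A w = d := by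
  let L := feasibleDirSubmodule hz
  -- The image of the conjugate face under the adjoint. By definition its dual cone is `{x | A x ∈
  -- tangentDir K z}`, which equals `L` by `h`.
  let C : PointedCone ℝ X :=
    { carrier := {c | ∃ w : Y, (∀ x ∈ K, 0 ≤ inner ℝ x w) ∧ inner ℝ z w = 0 ∧
        LinearMap.adjoint A w = c}
      add_mem' := by
        rintro _ _ ⟨w, hw, hwz, rfl⟩ ⟨w', hw', hwz', rfl⟩
        refine ⟨w + w', fun x hx => ?_, ?_, map_add _ _ _⟩
        · rw [inner_add_right]; exact add_nonneg (hw x hx) (hw' x hx)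
        · rw [inner_add_right, hwz, hwz', add_zero]
      zero_mem' := ⟨0, fun x _ => by simp, by simp, map_zero _⟩
      smul_mem' := by
        rintro ⟨a, ha⟩ _ ⟨w, hw, hwz, rfl⟩
        refine ⟨a • w, fun x hx => ?_, ?_, map_smul _ _ _⟩
        · rw [real_inner_smul_right]; exact mul_nonneg ha (hw x hx)
        · rw [real_inner_smul_right, hwz, mul_zero] }
  have hL : ∀ x, (∀ c ∈ C, 0 ≤ inner ℝ x c) → x ∈ L := fun x hx => h x fun w hw hwz => by
    rw [← LinearMap.adjoint_inner_right]
    exact hx _ ⟨w, hw, hwz, rfl⟩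
  have hLC : ∀ x ∈ L, ∀ c ∈ C, 0 ≤ inner ℝ x c := by
    rintro x ⟨ε, hε, hx⟩ _ ⟨w, hw, hwz, rfl⟩
    rw [LinearMap.adjoint_inner_right]
    have := hw _ hx
    rw [inner_add_left, hwz, zero_add, real_inner_smul_left] at this
    exact nonneg_of_mul_nonneg_right this hε
  have hneg : ∀ {c}, c ∈ C → -c ∈ C := fun hc =>
    neg_mem_of_forall_inner_eq_zero C (fun x hx c hc => le_antisymm (by
      have := hLC _ (L.neg_mem (hL x hx)) c hc
      rw [inner_neg_left] at this
      linarith) (hx c hc)) hc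
  let N : Submodule ℝ X :=
    { C with
      smul_mem' := by
        intro a c hc
        rcases le_total 0 a with ha | ha
        · exact PointedCone.smul_mem C ha hc
        · have := PointedCone.smul_mem C (neg_nonneg.2 ha) (hneg hc)
          rwa [neg_smul, smul_neg, neg_neg] at this }
  have hdN : d ∈ Nᗮᗮ := by
    rw [Submodule.mem_orthogonal]
    intro x hx
    refine (Submodule.mem_orthogonal _ _).1 hd x (hL x fun c hc => ?_)
    exact ((Submodule.mem_orthogonal' _ _).1 hx c hc).ge
  rw [Submodule.orthogonal_orthogonal] at hdN
  exact hdN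

/-- Riesz extension over `K` itself would need a Slater condition. The larger cone `s` absorbs every
vector along `z`, and by `hsK` it adds nothing to `K` among the directions feasible with both signs,
where the functional is prescribed. -/
theorem IsMaximumSlack.wellBehaved (hz : IsMaximumSlack A b K z)
    (h : ∀ x, A x ∈ tangentDir K z → A x ∈ feasibleDir K z) (s : PointedCone ℝ Y)
    (hKs : ∀ v ∈ K, v ∈ s) (hzs : ∀ y, ∃ l : ℝ, l • z + y ∈ s)
    (hsK : ∀ v ∈ s, v ∈ feasibleDir K z → -v ∈ feasibleDir K z → v ∈ K) :
    WellBehaved A b K := by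
  intro c r hr
  obtain ⟨⟨x₀, hx₀⟩, hzK⟩ := hz.mem
  let L := feasibleDirSubmodule hz
  set r' : ℝ := r - inner ℝ c x₀ with hr'
  have hle : ∀ x, z - A x ∈ K → inner ℝ c x ≤ r' := by
    intro x hx
    have hmem : x + x₀ ∈ feasibleSet A b K := by
      change b - A (x + x₀) ∈ K
      have : b - A (x + x₀) = z - A x := by rw [hx₀, map_add]; abel
      rwa [this]
    have := le_iSup₂ (f := fun y (_ : y ∈ feasibleSet A b K) => ((inner ℝ c y : ℝ) : EReal)) _ hmem
    change _ ≤ primalValue A b K c at this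
    rw [hr, EReal.coe_le_coe_iff, inner_add_right] at this
    linarith
  have hlub : ∀ B : ℝ, (∀ x, z - A x ∈ K → inner ℝ c x ≤ B) → r' ≤ B := by
    intro B hB
    have : primalValue A b K c ≤ ((B + inner ℝ c x₀ : ℝ) : EReal) := by
      refine iSup₂_le fun x hx => ?_
      rw [EReal.coe_le_coe_iff]
      have := hB (x - x₀) (by
        have : z - A (x - x₀) = b - A x := by rw [hx₀, map_sub]; abel
        rw [this]
        exact hx)
      rw [inner_sub_right] at this
      linarith
    rw [hr, EReal.coe_le_coe_iff] at this
    linarith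
  -- The bound homogenized, for `l` of any sign: averaging with `N` copies of a feasible `y`, where
  -- `N + l > 0`, gives a feasible point. Taking the supremum over `y` cancels the contribution of
  -- `N`.
  have hhom : ∀ (l : ℝ) (x : X), l • z - A x ∈ K → inner ℝ c x ≤ l * r' := by
    intro l x hx
    set N : ℝ := |l| + 1 with hN
    have hN0 : 0 < N := by positivity
    have hNl : 0 < N + l := by have := neg_abs_le l; linarith
    have := hlub ((l * r' - inner ℝ c x) / N + r') fun y hy => by
      have hmem := smul_mem_cone (inv_nonneg.2 hNl.le) (add_mem_cone (smul_mem_cone hN0.le hy) hx)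
      have heq : (N + l)⁻¹ • (N • (z - A y) + (l • z - A x)) =
          z - A ((N + l)⁻¹ • (N • y + x)) := by
        have : z = (N + l)⁻¹ • (N + l) • z := by
          rw [smul_smul, inv_mul_cancel₀ hNl.ne', one_smul]
        conv_rhs => rw [this]
        rw [map_smul, map_add, map_smul, ← smul_sub]
        congr 1
        module
      rw [heq] at hmem
      have := hle _ hmem
      rw [real_inner_smul_right, inner_add_right, real_inner_smul_right, inv_mul_le_iff₀ hNl]
        at this
      rw [div_add' _ _ _ hN0.ne', le_div_iff₀ hN0]
      linarith
    have h2 : 0 ≤ (l * r' - inner ℝ c x) / N := by linarith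
    rw [le_div_iff₀ hN0] at h2
    linarith
  let M : L × ℝ →ₗ[ℝ] Y :=
    (LinearMap.toSpanSingleton ℝ Y z).comp (LinearMap.snd ℝ L ℝ) -
      (A.comp L.subtype).comp (LinearMap.fst ℝ L ℝ)
  let φ : L × ℝ →ₗ[ℝ] ℝ :=
    r' • LinearMap.snd ℝ L ℝ - ((innerₗ X c).comp L.subtype).comp (LinearMap.fst ℝ L ℝ)
  have hM : ∀ q : L × ℝ, M q = q.2 • z - A q.1 := fun q => rfl
  have hφ : ∀ q : L × ℝ, φ q = r' * q.2 - inner ℝ c (q.1 : X) := fun q => rfl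
  obtain ⟨u, hu, hus⟩ := exists_inner_eq_of_nonneg s M φ
    (by
      intro q hq
      have hfeas : ∀ (x : X) (_ : x ∈ L) (l : ℝ), l • z - A x ∈ feasibleDir K z := by
        intro x hx l
        rw [sub_eq_neg_add]
        exact (add_smul_self_mem_feasibleDir_iff hzK l).2 (hz.neg_mem_feasibleDir hx)
      rw [hM] at hq
      have hmem := hsK _ hq (hfeas _ q.1.2 _) (by
        have := hfeas _ (L.neg_mem q.1.2) (-q.2)
        rw [map_neg] at this
        convert this using 1
        module)
      have := hhom _ _ hmem
      rw [hφ]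
      linarith)
    (fun y => by
      obtain ⟨l, hl⟩ := hzs y
      exact ⟨(0, l), by rw [hM]; simpa using hl⟩)
  have hzu : inner ℝ u z = r' := by
    have := hu (0, 1)
    rw [hM, hφ] at this
    simpa using this
  have hd : c - LinearMap.adjoint A u ∈ Lᗮ := by
    rw [Submodule.mem_orthogonal]
    intro x hx
    have := hu (⟨x, hx⟩, 0)
    rw [hM, hφ] at this
    simp only [zero_smul, zero_sub, inner_neg_right, mul_zero, neg_inj] at this
    rw [inner_sub_right, LinearMap.adjoint_inner_right, real_inner_comm, ← this, real_inner_comm,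
      sub_self]
  -- The representation by `u` is right on `L` only. The correction `w` repairs the adjoint equation
  -- and, being orthogonal to `z`, leaves the value unchanged.
  obtain ⟨w, hw, hwz, hwA⟩ := exists_adjoint_eq_of_mem_orthogonal hz h hd
  have hA : LinearMap.adjoint A (u + w) = c := by rw [map_add, hwA]; abel
  refine ⟨u + w, ⟨?_, hA⟩, ?_⟩
  · rw [ProperCone.mem_innerDual]
    intro x hx
    rw [inner_add_right, real_inner_comm]
    exact add_nonneg (hus x (hKs x hx)) (hw x hx)
  · have hb : b = z + A x₀ := by rw [hx₀]; abel
    rw [hb, inner_add_left, ← LinearMap.adjoint_inner_right, hA, inner_add_right, hwz,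
      real_inner_comm, hzu, hr', real_inner_comm c x₀]
    ring

end BadlyBehaved

end ConicSystem

/-! ### The second order cone -/

namespace SOCP

open Set Filter Topology ConicSystem

section SecondOrderCone

variable {d : ℕ} [NeZero d]

theorem mem_soc {x : EuclideanSpace ℝ (Fin d)} :
    x ∈ soc d ↔ 0 ≤ x 0 ∧ ∑ k ∈ Finset.univ.erase 0, x k ^ 2 ≤ x 0 ^ 2 :=
  Real.sqrt_le_iff

theorem inner_eq_add_sum_erase (x y : EuclideanSpace ℝ (Fin d)) :
    inner ℝ x y = x 0 * y 0 + ∑ k ∈ Finset.univ.erase 0, x k * y k := by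
  rw [Finset.add_sum_erase _ (fun k => x k * y k) (Finset.mem_univ _), PiLp.inner_apply]
  exact Finset.sum_congr rfl fun k _ => mul_comm _ _

theorem inner_nonneg_of_mem_soc {x y : EuclideanSpace ℝ (Fin d)} (hx : x ∈ soc d)
    (hy : y ∈ soc d) : 0 ≤ inner ℝ x y := by
  rw [mem_soc] at hx hy
  rw [inner_eq_add_sum_erase]
  have h : (∑ k ∈ Finset.univ.erase 0, x k * y k) ^ 2 ≤ (x 0 * y 0) ^ 2 := by
    rw [mul_pow]
    exact (Finset.sum_mul_sq_le_sq_mul_sq _ _ _).trans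
      (mul_le_mul hx.2 hy.2 (Finset.sum_nonneg fun _ _ => sq_nonneg _) (sq_nonneg _))
  have := (abs_le.1 (abs_le_of_sq_le_sq h (mul_nonneg hx.1 hy.1))).1
  linarith

/-- The second order cone is self-dual. -/
theorem mem_soc_of_forall_inner_nonneg {x : EuclideanSpace ℝ (Fin d)}
    (h : ∀ y ∈ soc d, 0 ≤ inner ℝ y x) : x ∈ soc d := by
  set q : ℝ := ∑ k ∈ Finset.univ.erase 0, x k ^ 2 with hq
  have hq0 : 0 ≤ q := Finset.sum_nonneg fun _ _ => sq_nonneg _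
  change √q ≤ x 0
  rcases hq0.eq_or_lt with h0 | hpos
  · rw [← h0, Real.sqrt_zero]
    have := h (EuclideanSpace.single 0 1) (mem_soc.2 ⟨by simp, by
      rw [Finset.sum_eq_zero fun k hk => by simp [Finset.ne_of_mem_erase hk]]
      exact sq_nonneg _⟩)
    simpa [EuclideanSpace.inner_single_left] using this
  · set y : EuclideanSpace ℝ (Fin d) := WithLp.toLp 2 fun k => if k = 0 then √q else -x k with hy
    have hy0 : y 0 = √q := by simp [hy]
    have hyk : ∀ k ∈ Finset.univ.erase 0, y k = -x k := fun k hk => by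
      simp [hy, Finset.ne_of_mem_erase hk]
    have := h y (mem_soc.2 ⟨by rw [hy0]; exact Real.sqrt_nonneg _, by
      rw [hy0, Real.sq_sqrt hq0, hq]
      exact (Finset.sum_congr rfl fun k hk => by rw [hyk k hk, neg_sq]).le⟩)
    have hs : ∑ k ∈ Finset.univ.erase 0, y k * x k = -q := by
      rw [hq, ← Finset.sum_neg_distrib]
      exact Finset.sum_congr rfl fun k hk => by rw [hyk k hk]; ring
    rw [inner_eq_add_sum_erase, hy0, hs] at this
    have hsq := Real.mul_self_sqrt hq0
    have hsp := Real.sqrt_pos.2 hpos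
    by_contra hlt
    nlinarith [mul_lt_mul_of_pos_left (not_le.1 hlt) hsp]

theorem single_add_mem_soc {x : EuclideanSpace ℝ (Fin d)} {l : ℝ} (hl : 2 * ‖x‖ ≤ l) :
    l • EuclideanSpace.single 0 1 + x ∈ soc d := by
  have hx0 : |x 0| ≤ ‖x‖ := PiLp.norm_apply_le x 0
  have hn := norm_nonneg x
  have h0 : (l • EuclideanSpace.single 0 1 + x : EuclideanSpace ℝ (Fin d)) 0 = l + x 0 := by simp
  have hle : ‖x‖ ≤ l + x 0 := by linarith [(abs_le.1 hx0).1]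
  rw [mem_soc, h0]
  refine ⟨hn.trans hle, ?_⟩
  calc _ = ∑ k ∈ Finset.univ.erase 0, x k ^ 2 :=
        Finset.sum_congr rfl fun k hk => by simp [Finset.ne_of_mem_erase hk]
    _ ≤ ∑ k, x k ^ 2 :=
        Finset.sum_le_sum_of_subset_of_nonneg (Finset.erase_subset _ _) fun _ _ _ => sq_nonneg _
    _ = ‖x‖ ^ 2 := (EuclideanSpace.real_norm_sq_eq x).symm
    _ ≤ _ := pow_le_pow_left₀ hn hle 2

theorem eventually_single_add_smul_mem_soc (v : EuclideanSpace ℝ (Fin d)) :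
    ∀ᶠ ε in 𝓝[>] (0 : ℝ), EuclideanSpace.single 0 1 + ε • v ∈ soc d := by
  have hlim : Tendsto (fun ε : ℝ => 2 * ‖ε • v‖) (𝓝[>] 0) (𝓝 0) := by
    have : Continuous fun ε : ℝ => 2 * ‖ε • v‖ := by fun_prop
    simpa using (this.tendsto 0).mono_left nhdsWithin_le_nhds
  filter_upwards [hlim.eventually_le_const one_pos] with ε hε
  simpa using single_add_mem_soc hε

theorem eq_zero_of_mem_soc {x : EuclideanSpace ℝ (Fin d)} (hx : x ∈ soc d) (h0 : x 0 = 0) :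
    x = 0 := by
  obtain ⟨-, h⟩ := mem_soc.1 hx
  rw [h0, zero_pow two_ne_zero] at h
  have := (Finset.sum_eq_zero_iff_of_nonneg fun _ _ => sq_nonneg _).1
    (le_antisymm h (Finset.sum_nonneg fun _ _ => sq_nonneg _))
  ext k
  rcases eq_or_ne k 0 with rfl | hk
  · exact h0
  · exact pow_eq_zero_iff two_ne_zero |>.1 (this k (Finset.mem_erase.2 ⟨hk, Finset.mem_univ _⟩))

theorem single_mem_soc : EuclideanSpace.single 0 1 ∈ soc d := by
  simpa using single_add_mem_soc (x := (0 : EuclideanSpace ℝ (Fin d))) (l := 1) (by simp)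

/-! #### The boundary point `(1, 1, 0, …, 0)` -/

variable (h : 2 ≤ d)

/-- The boundary point `(1, 1, 0, …, 0)` of the second order cone. -/
noncomputable def boundaryPoint : EuclideanSpace ℝ (Fin d) :=
  EuclideanSpace.single 0 1 + EuclideanSpace.single ⟨1, h⟩ 1

/-- The sum of the squares of the components of `x` other than the first two. -/
def tailSq (x : EuclideanSpace ℝ (Fin d)) : ℝ :=
  ∑ k ∈ (Finset.univ.erase 0).erase ⟨1, h⟩, x k ^ 2

theorem one_ne_zero_index : (⟨1, h⟩ : Fin d) ≠ 0 := by
  intro h'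
  simpa using congrArg Fin.val h'

theorem one_mem_erase : (⟨1, h⟩ : Fin d) ∈ Finset.univ.erase 0 :=
  Finset.mem_erase.2 ⟨one_ne_zero_index h, Finset.mem_univ _⟩

theorem tailSq_nonneg (x : EuclideanSpace ℝ (Fin d)) : 0 ≤ tailSq h x :=
  Finset.sum_nonneg fun _ _ => sq_nonneg _

theorem tailSq_eq_zero_iff {x : EuclideanSpace ℝ (Fin d)} :
    tailSq h x = 0 ↔ ∀ k, k ≠ 0 → k ≠ ⟨1, h⟩ → x k = 0 := by
  rw [tailSq, Finset.sum_eq_zero_iff_of_nonneg fun _ _ => sq_nonneg _]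
  simp only [Finset.mem_erase, Finset.mem_univ, and_true, and_imp, pow_eq_zero_iff two_ne_zero]
  exact forall_congr' fun k => ⟨fun h a b => h b a, fun h a b => h b a⟩

theorem mem_soc_iff_tailSq {x : EuclideanSpace ℝ (Fin d)} :
    x ∈ soc d ↔ 0 ≤ x 0 ∧ x ⟨1, h⟩ ^ 2 + tailSq h x ≤ x 0 ^ 2 := by
  rw [mem_soc, tailSq, Finset.add_sum_erase _ (fun k => x k ^ 2) (one_mem_erase h)]

theorem boundaryPoint_zero : boundaryPoint h 0 = 1 := by
  simp [boundaryPoint, (one_ne_zero_index h).symm]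

theorem boundaryPoint_one : boundaryPoint h ⟨1, h⟩ = 1 := by
  simp [boundaryPoint, one_ne_zero_index h]

theorem boundaryPoint_apply {k : Fin d} (hk : k ≠ 0) (hk' : k ≠ ⟨1, h⟩) :
    boundaryPoint h k = 0 := by
  simp [boundaryPoint, hk, hk']

theorem boundaryPoint_add_smul_mem_soc {v : EuclideanSpace ℝ (Fin d)} {ε : ℝ} :
    boundaryPoint h + ε • v ∈ soc d ↔
      0 ≤ 1 + ε * v 0 ∧ (1 + ε * v ⟨1, h⟩) ^ 2 + ε ^ 2 * tailSq h v ≤ (1 + ε * v 0) ^ 2 := by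
  have ht : tailSq h (boundaryPoint h + ε • v) = ε ^ 2 * tailSq h v := by
    rw [tailSq, tailSq, Finset.mul_sum]
    refine Finset.sum_congr rfl fun k hk => ?_
    simp only [Finset.mem_erase, Finset.mem_univ, and_true] at hk
    rw [PiLp.add_apply, PiLp.smul_apply, boundaryPoint_apply h hk.2 hk.1, smul_eq_mul]
    ring
  rw [mem_soc_iff_tailSq h, ht, PiLp.add_apply, PiLp.add_apply, boundaryPoint_zero,
    boundaryPoint_one, PiLp.smul_apply, PiLp.smul_apply, smul_eq_mul, smul_eq_mul]

theorem inner_eq_add_add_sum_erase (x y : EuclideanSpace ℝ (Fin d)) :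
    inner ℝ x y = x 0 * y 0 + (x ⟨1, h⟩ * y ⟨1, h⟩ +
      ∑ k ∈ (Finset.univ.erase 0).erase ⟨1, h⟩, x k * y k) := by
  rw [inner_eq_add_sum_erase, Finset.add_sum_erase _ (fun k => x k * y k) (one_mem_erase h)]

theorem inner_boundaryPoint (x : EuclideanSpace ℝ (Fin d)) :
    inner ℝ (boundaryPoint h) x = x 0 + x ⟨1, h⟩ := by
  rw [inner_eq_add_add_sum_erase h, boundaryPoint_zero, boundaryPoint_one,
    Finset.sum_eq_zero fun k hk => ?_]
  · ring
  · simp only [Finset.mem_erase, Finset.mem_univ, and_true] at hk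
    rw [boundaryPoint_apply h hk.2 hk.1, zero_mul]

theorem boundaryPoint_mem_soc : boundaryPoint h ∈ soc d := by
  have := (boundaryPoint_add_smul_mem_soc h (v := 0) (ε := 0)).2 (by norm_num)
  simpa using this

theorem tailSq_eq_zero_of_boundaryPoint_add_smul_mem {v : EuclideanSpace ℝ (Fin d)} {ε : ℝ}
    (hε : 0 < ε) (hmem : boundaryPoint h + ε • v ∈ soc d) (hv : v ⟨1, h⟩ = v 0) :
    tailSq h v = 0 := by
  have := ((boundaryPoint_add_smul_mem_soc h).1 hmem).2
  rw [hv] at this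
  have h2 : ε ^ 2 * tailSq h v ≤ 0 := by linarith
  exact le_antisymm (nonpos_of_mul_nonpos_right h2 (by positivity)) (tailSq_nonneg h v)

/-- The cone inequality at `boundaryPoint h + ε • v` has slack `ε` times a function of `ε` which
tends to `2 * (v 0 - v ⟨1, h⟩)`. If this limit is zero, only the tail can violate the inequality. -/
theorem eventually_boundaryPoint_add_smul_mem_soc {v : EuclideanSpace ℝ (Fin d)}
    (hle : v ⟨1, h⟩ ≤ v 0) (htail : v ⟨1, h⟩ = v 0 → tailSq h v = 0) :
    ∀ᶠ ε in 𝓝[>] (0 : ℝ), boundaryPoint h + ε • v ∈ soc d := by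
  have hlim : ∀ f : ℝ → ℝ, Continuous f → Tendsto f (𝓝[>] 0) (𝓝 (f 0)) := fun f hf =>
    (hf.tendsto 0).mono_left nhdsWithin_le_nhds
  have h0 : ∀ᶠ ε in 𝓝[>] (0 : ℝ), 0 ≤ 1 + ε * v 0 :=
    (hlim (fun ε => 1 + ε * v 0) (by fun_prop)).eventually_const_le (by simp)
  rcases hle.eq_or_lt with heq | hlt
  · filter_upwards [h0] with ε hε
    rw [boundaryPoint_add_smul_mem_soc, htail heq, heq]
    exact ⟨hε, by simp⟩
  · have h1 : ∀ᶠ ε in 𝓝[>] (0 : ℝ),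
        0 ≤ (v 0 - v ⟨1, h⟩) * (2 + ε * (v 0 + v ⟨1, h⟩)) - ε * tailSq h v :=
      (hlim (fun ε => (v 0 - v ⟨1, h⟩) * (2 + ε * (v 0 + v ⟨1, h⟩)) - ε * tailSq h v)
        (by fun_prop)).eventually_const_le (by simpa using hlt)
    filter_upwards [h0, h1, self_mem_nhdsWithin] with ε hε hε' hpos
    rw [boundaryPoint_add_smul_mem_soc]
    refine ⟨hε, ?_⟩
    have := mul_nonneg (le_of_lt hpos) hε'
    linear_combination this

/-- Orthogonality to the boundary point forces `w` onto the ray of `(1, -1, 0, …, 0)`. -/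
theorem inner_nonneg_of_inner_boundaryPoint_eq_zero {v w : EuclideanSpace ℝ (Fin d)}
    (hw : w ∈ soc d) (hw0 : inner ℝ (boundaryPoint h) w = 0) (hv : v ⟨1, h⟩ ≤ v 0) :
    0 ≤ inner ℝ v w := by
  rw [inner_boundaryPoint] at hw0
  have hw1 : w ⟨1, h⟩ = -w 0 := by linarith
  obtain ⟨hpos, hsq⟩ := (mem_soc_iff_tailSq h).1 hw
  rw [hw1] at hsq
  have ht := (tailSq_eq_zero_iff h).1 (le_antisymm (by linarith) (tailSq_nonneg h w))
  rw [inner_eq_add_add_sum_erase h, hw1, Finset.sum_eq_zero fun k hk => ?_]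
  · have := mul_nonneg hpos (sub_nonneg.2 hv)
    linarith
  · simp only [Finset.mem_erase, Finset.mem_univ, and_true] at hk
    rw [ht k hk.2 hk.1, mul_zero]

/-- In the inequalities for `v` and `-v` the linear terms are opposite. Adding them leaves `(ε + δ)
* q ≤ 0`, so the quadratic form has the right sign and only `0 ≤ v 0` remains to be required. -/
theorem mem_soc_of_boundaryPoint_add_smul_mem {v : EuclideanSpace ℝ (Fin d)} {ε δ : ℝ}
    (hε : 0 < ε) (hδ : 0 < δ) (hmem : boundaryPoint h + ε • v ∈ soc d)
    (hmem' : boundaryPoint h + δ • (-v) ∈ soc d) (hv : 0 ≤ v 0) : v ∈ soc d := by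
  rw [smul_neg, ← neg_smul, boundaryPoint_add_smul_mem_soc] at hmem'
  rw [boundaryPoint_add_smul_mem_soc] at hmem
  refine (mem_soc_iff_tailSq h).2 ⟨hv, ?_⟩
  set q := v ⟨1, h⟩ ^ 2 + tailSq h v - v 0 ^ 2 with hq
  have h1 : ε * (2 * (v ⟨1, h⟩ - v 0) + ε * q) ≤ 0 := by rw [hq]; linear_combination hmem.2
  have h2 : δ * (-2 * (v ⟨1, h⟩ - v 0) + δ * q) ≤ 0 := by rw [hq]; linear_combination hmem'.2
  have h3 := nonpos_of_mul_nonpos_right h1 hε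
  have h4 := nonpos_of_mul_nonpos_right h2 hδ
  have h5 : (ε + δ) * q ≤ 0 := by linarith
  have := nonpos_of_mul_nonpos_right h5 (by positivity)
  linarith

/-- The boundary point `(1, -1, 0, …, 0)` spans the ray conjugate to `(1, 1, 0, …, 0)`. -/
theorem single_sub_single_mem_soc :
    (EuclideanSpace.single 0 1 - EuclideanSpace.single ⟨1, h⟩ 1 : EuclideanSpace ℝ (Fin d)) ∈
      soc d := by
  have h10 := one_ne_zero_index h
  have ht : tailSq h (EuclideanSpace.single 0 1 - EuclideanSpace.single ⟨1, h⟩ 1) = 0 :=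
    (tailSq_eq_zero_iff h).2 fun k hk hk' => by simp [hk, hk']
  rw [mem_soc_iff_tailSq h, ht]
  simp [h10, h10.symm]

end SecondOrderCone

/-! ### Products of second order cones -/

section Product

variable {t : ℕ} {m : Fin t → ℕ}

/-- The vector with the given blocks. -/
def ofBlocks (f : ∀ i, EuclideanSpace ℝ (Fin (m i))) : EuclideanSpace ℝ (Σ i, Fin (m i)) :=
  WithLp.toLp 2 fun p => f p.1 p.2

@[simp]
theorem block_ofBlocks (f : ∀ i, EuclideanSpace ℝ (Fin (m i))) (i : Fin t) :
    block (ofBlocks f) i = f i := rfl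

@[simp]
theorem block_add (v w : EuclideanSpace ℝ (Σ i, Fin (m i))) (i : Fin t) :
    block (v + w) i = block v i + block w i := rfl

@[simp]
theorem block_neg (v : EuclideanSpace ℝ (Σ i, Fin (m i))) (i : Fin t) :
    block (-v) i = -block v i := rfl

@[simp]
theorem block_smul (a : ℝ) (v : EuclideanSpace ℝ (Σ i, Fin (m i))) (i : Fin t) :
    block (a • v) i = a • block v i := rfl

theorem ext_block {v w : EuclideanSpace ℝ (Σ i, Fin (m i))} (h : ∀ i, block v i = block w i) :
    v = w := by
  ext ⟨i, k⟩
  exact congrArg (fun u : EuclideanSpace ℝ (Fin (m i)) => u k) (h i)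

theorem inner_eq_sum_block (v w : EuclideanSpace ℝ (Σ i, Fin (m i))) :
    inner ℝ v w = ∑ i, inner ℝ (block v i) (block w i) := by
  simp only [PiLp.inner_apply, Fintype.sum_sigma]
  rfl

theorem inner_ofBlocks_single (v : EuclideanSpace ℝ (Σ i, Fin (m i))) (i : Fin t)
    (y : EuclideanSpace ℝ (Fin (m i))) :
    inner ℝ v (ofBlocks (Pi.single i y)) = inner ℝ (block v i) y := by
  rw [inner_eq_sum_block, Finset.sum_eq_single i, block_ofBlocks, Pi.single_eq_same]
  · intro j _ hj
    rw [block_ofBlocks, Pi.single_eq_of_ne hj, inner_zero_right]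
  · simp

theorem norm_block_le (v : EuclideanSpace ℝ (Σ i, Fin (m i))) (i : Fin t) :
    ‖block v i‖ ≤ ‖v‖ := by
  refine le_of_sq_le_sq ?_ (norm_nonneg _)
  rw [← real_inner_self_eq_norm_sq, ← real_inner_self_eq_norm_sq, inner_eq_sum_block]
  exact Finset.single_le_sum (f := fun i => inner ℝ (block v i) (block v i))
    (fun _ _ => real_inner_self_nonneg) (Finset.mem_univ i)

variable [∀ i, NeZero (m i)]

theorem mem_socProd {v : EuclideanSpace ℝ (Σ i, Fin (m i))} :
    v ∈ socProd m ↔ ∀ i, block v i ∈ soc (m i) := Iff.rfl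

theorem zero_mem_soc {d : ℕ} [NeZero d] : (0 : EuclideanSpace ℝ (Fin d)) ∈ soc d :=
  (soc d).toSubmodule.zero_mem

theorem ofBlocks_single_mem_socProd {i : Fin t} {y : EuclideanSpace ℝ (Fin (m i))}
    (hy : y ∈ soc (m i)) : ofBlocks (Pi.single i y) ∈ socProd m := by
  intro j
  rw [block_ofBlocks]
  rcases eq_or_ne j i with rfl | hj
  · rwa [Pi.single_eq_same]
  · rw [Pi.single_eq_of_ne hj]
    exact zero_mem_soc

theorem inner_nonneg_of_mem_socProd {v w : EuclideanSpace ℝ (Σ i, Fin (m i))}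
    (hv : v ∈ socProd m) (hw : w ∈ socProd m) : 0 ≤ inner ℝ v w := by
  rw [inner_eq_sum_block]
  exact Finset.sum_nonneg fun i _ => inner_nonneg_of_mem_soc (hv i) (hw i)

theorem mem_socProd_of_forall_inner_nonneg {w : EuclideanSpace ℝ (Σ i, Fin (m i))}
    (h : ∀ x ∈ socProd m, 0 ≤ inner ℝ x w) : w ∈ socProd m := by
  intro i
  refine mem_soc_of_forall_inner_nonneg fun y hy => ?_
  rw [real_inner_comm, ← inner_ofBlocks_single, real_inner_comm]
  exact h _ (ofBlocks_single_mem_socProd hy)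

theorem exists_sub_mem_socProd (y : EuclideanSpace ℝ (Σ i, Fin (m i))) :
    ∃ u ∈ socProd m, ∃ v ∈ socProd m, y = u - v := by
  let e : EuclideanSpace ℝ (Σ i, Fin (m i)) := ofBlocks fun i => EuclideanSpace.single 0 1
  refine ⟨(2 * ‖y‖) • e + y, fun i => ?_, (2 * ‖y‖) • e, fun i => ?_, by abel⟩
  · rw [block_add, block_smul, block_ofBlocks]
    exact single_add_mem_soc (by have := norm_block_le y i; linarith)
  · rw [block_smul, block_ofBlocks]
    exact smul_mem_cone (by positivity) single_mem_soc

variable {z v : EuclideanSpace ℝ (Σ i, Fin (m i))}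

theorem IsNormalized.mem_socProd (hz : IsNormalized z) : z ∈ socProd m := by
  intro i
  rcases hz i with h | ⟨h2, h⟩ | h
  · rw [show block z i = 0 from h]
    exact zero_mem_soc
  · rw [h]
    exact boundaryPoint_mem_soc h2
  · rw [show block z i = EuclideanSpace.single 0 1 from h]
    exact single_mem_soc

/-- By self-duality the conjugate face splits into blocks: the whole cone over `O`, the ray of `(1,
-1, 0, …, 0)` over `R`, and `0` over `I`. -/
theorem IsNormalized.mem_tangentDir_iff (hz : IsNormalized z) :
    v ∈ tangentDir (socProd m) z ↔ (∀ i ∈ indexO z, block v i ∈ soc (m i)) ∧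
      ∀ i ∈ indexR z, ∀ h : 2 ≤ m i, block v i ⟨1, h⟩ ≤ block v i 0 := by
  constructor
  · intro hv
    have key : ∀ i, ∀ y ∈ soc (m i), inner ℝ (block z i) y = 0 → 0 ≤ inner ℝ (block v i) y := by
      intro i y hy hzy
      rw [← inner_ofBlocks_single]
      refine hv _ (fun x hx => inner_nonneg_of_mem_socProd hx (ofBlocks_single_mem_socProd hy)) ?_
      rwa [inner_ofBlocks_single]
    refine ⟨fun i hi => ?_, fun i hi h => ?_⟩
    · refine mem_soc_of_forall_inner_nonneg fun y hy => ?_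
      rw [real_inner_comm]
      refine key i y hy ?_
      rw [show block z i = 0 from hi, inner_zero_left]
    · obtain ⟨_, hi⟩ := hi
      have := key i _ (single_sub_single_mem_soc h) (by
        rw [hi]
        change inner ℝ (boundaryPoint h) _ = 0
        rw [inner_boundaryPoint]
        simp [one_ne_zero_index h, (one_ne_zero_index h).symm])
      rw [inner_sub_right] at this
      simpa [EuclideanSpace.inner_single_right] using this
  · rintro ⟨hO, hR⟩ w hw hzw
    have hwK := mem_socProd_of_forall_inner_nonneg hw
    rw [inner_eq_sum_block, Finset.sum_eq_zero_iff_of_nonneg fun i _ =>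
      inner_nonneg_of_mem_soc (hz.mem_socProd i) (hwK i)] at hzw
    rw [inner_eq_sum_block]
    refine Finset.sum_nonneg fun i _ => ?_
    have hi := hzw i (Finset.mem_univ i)
    rcases hz i with h | h | h
    · exact inner_nonneg_of_mem_soc (hO i h) (hwK i)
    · obtain ⟨h2, h'⟩ := id h
      rw [h'] at hi
      exact inner_nonneg_of_inner_boundaryPoint_eq_zero h2 (hwK i) hi (hR i h h2)
    · rw [show block z i = EuclideanSpace.single 0 1 from h] at hi
      rw [eq_zero_of_mem_soc (hwK i) (by simpa [EuclideanSpace.inner_single_left] using hi), inner_zero_right]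

/-- Each block admits all sufficiently small positive steps, so finitely many blocks share one. -/
theorem IsNormalized.mem_feasibleDir (hz : IsNormalized z) (hv : v ∈ tangentDir (socProd m) z)
    (htail : ∀ i ∈ indexR z, ∀ h : 2 ≤ m i, block v i ⟨1, h⟩ = block v i 0 →
      tailSq h (block v i) = 0) : v ∈ feasibleDir (socProd m) z := by
  obtain ⟨hO, hR⟩ := hz.mem_tangentDir_iff.1 hv
  have hev : ∀ᶠ ε in 𝓝[>] (0 : ℝ), ∀ i, block z i + ε • block v i ∈ soc (m i) := by
    rw [eventually_all]
    intro i
    rcases hz i with h | h | h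
    · filter_upwards [self_mem_nhdsWithin] with ε hε
      rw [show block z i = 0 from h, zero_add]
      exact smul_mem_cone (le_of_lt hε) (hO i h)
    · obtain ⟨h2, h'⟩ := id h
      rw [h']
      exact eventually_boundaryPoint_add_smul_mem_soc h2 (hR i h h2) (htail i h h2)
    · rw [show block z i = EuclideanSpace.single 0 1 from h]
      exact eventually_single_add_smul_mem_soc _
  obtain ⟨ε, hε, hpos⟩ := (hev.and self_mem_nhdsWithin).exists
  exact ⟨ε, hpos, hε⟩

theorem tailSq_eq_zero_of_mem_feasibleDir (hv : v ∈ feasibleDir (socProd m) z) {i : Fin t}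
    (hi : i ∈ indexR z) (h : 2 ≤ m i) (heq : block v i ⟨1, h⟩ = block v i 0) :
    tailSq h (block v i) = 0 := by
  obtain ⟨ε, hε, hmem⟩ := hv
  obtain ⟨_, hi⟩ := hi
  have := hmem i
  rw [block_add, block_smul, hi] at this
  exact tailSq_eq_zero_of_boundaryPoint_add_smul_mem h hε this heq

/-- The vectors with a nonnegative first component in the blocks of `R` and with the blocks of `I`
in the second order cone. -/
def relaxedCone (z : EuclideanSpace ℝ (Σ i, Fin (m i))) :
    PointedCone ℝ (EuclideanSpace ℝ (Σ i, Fin (m i))) where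
  carrier := {v | (∀ i ∈ indexR z, 0 ≤ block v i 0) ∧ ∀ i ∈ indexI z, block v i ∈ soc (m i)}
  add_mem' hu hv := ⟨fun i hi => add_nonneg (hu.1 i hi) (hv.1 i hi),
    fun i hi => add_mem_cone (hu.2 i hi) (hv.2 i hi)⟩
  zero_mem' := ⟨fun _ _ => le_rfl, fun _ _ => zero_mem_soc⟩
  smul_mem' a _ hv := ⟨fun i hi => mul_nonneg a.2 (hv.1 i hi),
    fun i hi => smul_mem_cone a.2 (hv.2 i hi)⟩

theorem exists_smul_add_mem_relaxedCone (z y : EuclideanSpace ℝ (Σ i, Fin (m i))) :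
    ∃ l : ℝ, l • z + y ∈ relaxedCone z := by
  refine ⟨2 * ‖y‖, fun i hi => ?_, fun i hi => ?_⟩
  · obtain ⟨h, hi⟩ := hi
    have h0 : block z i 0 = 1 := by rw [hi]; exact boundaryPoint_zero h
    rw [block_add, block_smul, PiLp.add_apply, PiLp.smul_apply, h0, smul_eq_mul, mul_one]
    have h1 : |block y i 0| ≤ ‖block y i‖ := PiLp.norm_apply_le (block y i) 0
    have h2 := norm_block_le y i
    have h3 := (abs_le.1 h1).1
    have h4 := norm_nonneg y
    linarith
  · rw [block_add, block_smul, show block z i = EuclideanSpace.single 0 1 from hi]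
    exact single_add_mem_soc (by have := norm_block_le y i; linarith)

/-- The constraints dropped in the relaxed cone are recovered from feasibility: over `O` from that
of `v`, over `R` from that of `v` and `-v` together. -/
theorem IsNormalized.mem_socProd_of_mem_relaxedCone (hz : IsNormalized z)
    (hv : v ∈ relaxedCone z) (hpos : v ∈ feasibleDir (socProd m) z)
    (hneg : -v ∈ feasibleDir (socProd m) z) : v ∈ socProd m := by
  intro i
  obtain ⟨ε, hε, hmem⟩ := hpos
  obtain ⟨δ, hδ, hmem'⟩ := hneg
  have h1 := hmem i
  have h2 := hmem' i
  rw [block_add, block_smul] at h1 h2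
  rw [block_neg] at h2
  rcases hz i with h | h | h
  · rw [show block z i = 0 from h, zero_add] at h1 h2
    have h1' := smul_mem_cone (inv_nonneg.2 hε.le) h1
    have h2' := smul_mem_cone (inv_nonneg.2 hδ.le) h2
    rw [inv_smul_smul₀ hε.ne'] at h1'
    exact h1'
  · have h0 := hv.1 i h
    obtain ⟨hd, h⟩ := h
    rw [h] at h1 h2
    exact mem_soc_of_boundaryPoint_add_smul_mem hd hε hδ h1 h2 h0
  · exact hv.2 i h

/-- Characterization of the badly behaved systems by a direction in the range of `A`. -/
theorem badlyBehaved_iff_exists_mem_tangentDir {X : Type*} [NormedAddCommGroup X]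
    [InnerProductSpace ℝ X] [FiniteDimensional ℝ X]
    {A : X →ₗ[ℝ] EuclideanSpace ℝ (Σ i, Fin (m i))} {b : EuclideanSpace ℝ (Σ i, Fin (m i))}
    (hmax : IsMaximumSlack A b (socProd m) z) (hz : IsNormalized z) :
    BadlyBehaved A b (socProd m) ↔
      ∃ x, A x ∈ tangentDir (socProd m) z ∧ A x ∉ feasibleDir (socProd m) z := by
  constructor
  · intro hbad
    by_contra! h
    exact hbad (hmax.wellBehaved h (relaxedCone z)
      (fun v hv => ⟨fun i _ => (mem_soc.1 (hv i)).1, fun i _ => hv i⟩)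
      (exists_smul_add_mem_relaxedCone z)
      fun v hv h1 h2 => hz.mem_socProd_of_mem_relaxedCone hv h1 h2)
  · rintro ⟨x, hx, hx'⟩
    exact hmax.badlyBehaved_of_mem_tangentDir hx hx'

theorem IsNormalized.not_mem_feasibleDir_of_isCertificate (hz : IsNormalized z)
    (hv : IsCertificate z v) :
    v ∈ tangentDir (socProd m) z ∧ v ∉ feasibleDir (socProd m) z := by
  refine ⟨hz.mem_tangentDir_iff.2 ⟨hv.mem_cone, hv.second_le_first⟩, fun hfeas => ?_⟩
  obtain ⟨j, hj, h, α, h0, h1, h2⟩ := hv.exists_form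
  have := (tailSq_eq_zero_iff (by omega)).1
    (tailSq_eq_zero_of_mem_feasibleDir hfeas hj (by omega) (h1.trans h0.symm)) ⟨2, h⟩
    (fun h' => by simpa using congrArg Fin.val h') (fun h' => by simpa using congrArg Fin.val h')
  rw [h2] at this
  exact one_ne_zero this

end Product

end SOCP

/-! ### Block-diagonal transformations -/

namespace SOCP

open Set Filter Topology ConicSystem

section Transformation

variable {t n : ℕ} {m : Fin t → ℕ}

theorem block_toEuclideanLin_blockDiagonal' (T : ∀ i, Matrix (Fin (m i)) (Fin (m i)) ℝ)
    (v : EuclideanSpace ℝ (Σ i, Fin (m i))) (i : Fin t) :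
    block (Matrix.toEuclideanLin (Matrix.blockDiagonal' T) v) i =
      Matrix.toEuclideanLin (T i) (block v i) := by
  ext k
  change ∑ q : (Σ i, Fin (m i)), Matrix.blockDiagonal' T ⟨i, k⟩ q * v q =
    ∑ l, T i k l * v ⟨i, l⟩
  rw [Fintype.sum_sigma, Finset.sum_eq_single i]
  · exact Finset.sum_congr rfl fun l _ => by rw [Matrix.blockDiagonal'_apply_eq]
  · intro j _ hj
    exact Finset.sum_eq_zero fun l _ => by
      rw [Matrix.blockDiagonal'_apply_ne _ _ _ hj.symm, zero_mul]
  · simp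

theorem toEuclideanLin_mul_apply {ι κ : Type*} [Fintype ι] [DecidableEq ι] [Fintype κ]
    [DecidableEq κ] (M : Matrix ι ι ℝ) (A : Matrix ι κ ℝ) (x : EuclideanSpace ℝ κ) :
    Matrix.toEuclideanLin (M * A) x = Matrix.toEuclideanLin M (Matrix.toEuclideanLin A x) := by
  simp [Matrix.toLpLin_apply, Matrix.mulVec_mulVec]

theorem mem_columnSpan {A : Matrix (Σ i, Fin (m i)) (Fin n) ℝ}
    {b v : EuclideanSpace ℝ (Σ i, Fin (m i))} :
    v ∈ columnSpan A b ↔ ∃ (l : ℝ) (x : EuclideanSpace ℝ (Fin n)),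
      v = Matrix.toEuclideanLin A x + l • b := by
  have hsum : ∀ x : EuclideanSpace ℝ (Fin n),
      ∑ j, x j • (WithLp.toLp 2 (A.col j) : EuclideanSpace ℝ (Σ i, Fin (m i))) =
        Matrix.toEuclideanLin A x := by
    intro x
    ext k
    simp [Matrix.toLpLin_apply, Matrix.mulVec, dotProduct, mul_comm]
  rw [columnSpan, Submodule.mem_span_insert]
  constructor
  · rintro ⟨l, u, hu, rfl⟩
    obtain ⟨x, rfl⟩ := (Submodule.mem_span_range_iff_exists_fun ℝ).1 hu
    exact ⟨l, WithLp.toLp 2 x, by rw [← hsum, add_comm]⟩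
  · rintro ⟨l, x, rfl⟩
    exact ⟨l, _, (Submodule.mem_span_range_iff_exists_fun ℝ).2 ⟨x, rfl⟩, by rw [hsum, add_comm]⟩

theorem inner_toEuclideanLin_of_isSymm {d : ℕ} {M : Matrix (Fin d) (Fin d) ℝ} (hM : M.IsSymm)
    (x y : EuclideanSpace ℝ (Fin d)) :
    inner ℝ (Matrix.toEuclideanLin M x) y = inner ℝ x (Matrix.toEuclideanLin M y) := by
  have h : (Matrix.toEuclideanLin M).IsSymmetric := by
    rw [Matrix.isSymmetric_toEuclideanLin_iff, Matrix.IsHermitian, Matrix.conjTranspose_eq_transpose_of_trivial]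
    exact hM
  exact h x y

variable [∀ i, NeZero (m i)] {T : ∀ i, Matrix (Fin (m i)) (Fin (m i)) ℝ}
  {z u v : EuclideanSpace ℝ (Σ i, Fin (m i))}

namespace IsAdmissible

theorem map_mem_socProd (hT : IsAdmissible T z) (hv : v ∈ socProd m) :
    Matrix.toEuclideanLin (Matrix.blockDiagonal' T) v ∈ socProd m := by
  intro i
  rw [block_toEuclideanLin_blockDiagonal']
  have := mem_image_of_mem (Matrix.toEuclideanLin (T i)) (hv i)
  rwa [hT.image_cone i] at this

theorem exists_map_eq_of_mem_socProd (hT : IsAdmissible T z) (hv : v ∈ socProd m) :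
    ∃ u ∈ socProd m, Matrix.toEuclideanLin (Matrix.blockDiagonal' T) u = v := by
  have : ∀ i, ∃ y ∈ soc (m i), Matrix.toEuclideanLin (T i) y = block v i := by
    intro i
    have := hv i
    rwa [← SetLike.mem_coe, ← hT.image_cone i] at this
  choose f hf hfv using this
  exact ⟨ofBlocks f, hf, ext_block fun i => by
    rw [block_toEuclideanLin_blockDiagonal', block_ofBlocks, hfv]⟩

theorem inner_map (hT : IsAdmissible T z) :
    inner ℝ (Matrix.toEuclideanLin (Matrix.blockDiagonal' T) u) v =
      inner ℝ u (Matrix.toEuclideanLin (Matrix.blockDiagonal' T) v) := by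
  rw [inner_eq_sum_block, inner_eq_sum_block]
  exact Finset.sum_congr rfl fun i _ => by
    rw [block_toEuclideanLin_blockDiagonal', block_toEuclideanLin_blockDiagonal',
      inner_toEuclideanLin_of_isSymm (hT.symm i)]

theorem exists_map_eq (hT : IsAdmissible T z) (v : EuclideanSpace ℝ (Σ i, Fin (m i))) :
    ∃ u, Matrix.toEuclideanLin (Matrix.blockDiagonal' T) u = v := by
  obtain ⟨p, hp, q, hq, rfl⟩ := exists_sub_mem_socProd v
  obtain ⟨p', -, rfl⟩ := hT.exists_map_eq_of_mem_socProd hp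
  obtain ⟨q', -, rfl⟩ := hT.exists_map_eq_of_mem_socProd hq
  exact ⟨p' - q', map_sub _ _ _⟩

/-- The map is self-adjoint and onto, and it maps the cone onto itself and fixes `z`. Hence any
preimage of an element of the conjugate face is again in that face. -/
theorem mem_tangentDir_of_map_mem (hT : IsAdmissible T z)
    (hu : Matrix.toEuclideanLin (Matrix.blockDiagonal' T) u ∈ tangentDir (socProd m) z) :
    u ∈ tangentDir (socProd m) z := by
  intro w hw hzw
  obtain ⟨w, rfl⟩ := hT.exists_map_eq w
  rw [← hT.inner_map]
  refine hu w (fun x hx => ?_) ?_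
  · obtain ⟨y, hy, rfl⟩ := hT.exists_map_eq_of_mem_socProd hx
    rw [hT.inner_map]
    exact hw y hy
  · rwa [← hT.inner_map, hT.fix_slack] at hzw

theorem map_mem_feasibleDir (hT : IsAdmissible T z) (hu : u ∈ feasibleDir (socProd m) z) :
    Matrix.toEuclideanLin (Matrix.blockDiagonal' T) u ∈ feasibleDir (socProd m) z := by
  obtain ⟨ε, hε, hmem⟩ := hu
  refine ⟨ε, hε, ?_⟩
  have := hT.map_mem_socProd hmem
  rwa [map_add, map_smul, hT.fix_slack] at this

end IsAdmissible

end Transformation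

/-! ### Signed transpositions of components -/

section SignedSwap

variable {d : ℕ} [NeZero d]

/-- The matrix which swaps the components `c` and `k` and multiplies all components but the first
two by `σ`. -/
def signedSwap (h : 2 ≤ d) (c k : Fin d) (σ : ℝ) : Matrix (Fin d) (Fin d) ℝ :=
  Matrix.of fun a l =>
    if l = Equiv.swap c k a then (if a = 0 ∨ a = ⟨1, h⟩ then 1 else σ) else 0

variable {h : 2 ≤ d} {c k : Fin d} {σ : ℝ}

theorem toEuclideanLin_signedSwap (x : EuclideanSpace ℝ (Fin d)) (a : Fin d) :
    Matrix.toEuclideanLin (signedSwap h c k σ) x a =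
      (if a = 0 ∨ a = ⟨1, h⟩ then 1 else σ) * x (Equiv.swap c k a) := by
  change ∑ l, signedSwap h c k σ a l * x l = _
  simp [signedSwap]

theorem swap_eq_zero_or_one_iff (hc : c ≠ 0) (hc' : c ≠ ⟨1, h⟩) (hk : k ≠ 0) (hk' : k ≠ ⟨1, h⟩)
    (a : Fin d) : (Equiv.swap c k a = 0 ∨ Equiv.swap c k a = ⟨1, h⟩) ↔ a = 0 ∨ a = ⟨1, h⟩ := by
  rw [Equiv.swap_apply_eq_iff, Equiv.swap_apply_eq_iff,
    Equiv.swap_apply_of_ne_of_ne hc.symm hk.symm, Equiv.swap_apply_of_ne_of_ne hc'.symm hk'.symm]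

theorem isSymm_signedSwap (hc : c ≠ 0) (hc' : c ≠ ⟨1, h⟩) (hk : k ≠ 0) (hk' : k ≠ ⟨1, h⟩) :
    (signedSwap h c k σ).IsSymm := by
  ext a l
  rw [Matrix.transpose_apply, signedSwap, Matrix.of_apply, Matrix.of_apply]
  have hiff : a = Equiv.swap c k l ↔ l = Equiv.swap c k a := by
    rw [eq_comm, Equiv.swap_apply_eq_iff]
  by_cases hl : l = Equiv.swap c k a
  · rw [if_pos hl, if_pos (hiff.2 hl), hl]
    simp only [swap_eq_zero_or_one_iff hc hc' hk hk']
  · rw [if_neg hl, if_neg (mt hiff.1 hl)]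

theorem toEuclideanLin_signedSwap_signedSwap (hc : c ≠ 0) (hc' : c ≠ ⟨1, h⟩) (hk : k ≠ 0)
    (hk' : k ≠ ⟨1, h⟩) (hσ : σ ^ 2 = 1) (x : EuclideanSpace ℝ (Fin d)) :
    Matrix.toEuclideanLin (signedSwap h c k σ) (Matrix.toEuclideanLin (signedSwap h c k σ) x) =
      x := by
  ext a
  rw [toEuclideanLin_signedSwap, toEuclideanLin_signedSwap, Equiv.swap_apply_self]
  simp only [swap_eq_zero_or_one_iff hc hc' hk hk']
  split_ifs
  · ring
  · linear_combination x a * hσ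

theorem toEuclideanLin_signedSwap_zero (hc : c ≠ 0) (hk : k ≠ 0)
    (x : EuclideanSpace ℝ (Fin d)) :
    Matrix.toEuclideanLin (signedSwap h c k σ) x 0 = x 0 := by
  rw [toEuclideanLin_signedSwap, if_pos (Or.inl rfl), one_mul,
    Equiv.swap_apply_of_ne_of_ne hc.symm hk.symm]

theorem toEuclideanLin_signedSwap_one (hc' : c ≠ ⟨1, h⟩) (hk' : k ≠ ⟨1, h⟩)
    (x : EuclideanSpace ℝ (Fin d)) :
    Matrix.toEuclideanLin (signedSwap h c k σ) x ⟨1, h⟩ = x ⟨1, h⟩ := by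
  rw [toEuclideanLin_signedSwap, if_pos (Or.inr rfl), one_mul,
    Equiv.swap_apply_of_ne_of_ne hc'.symm hk'.symm]

theorem toEuclideanLin_signedSwap_mem_soc (hc : c ≠ 0) (hk : k ≠ 0) (hσ : σ ^ 2 = 1)
    {x : EuclideanSpace ℝ (Fin d)} (hx : x ∈ soc d) :
    Matrix.toEuclideanLin (signedSwap h c k σ) x ∈ soc d := by
  rw [mem_soc] at hx ⊢
  rw [toEuclideanLin_signedSwap_zero hc hk]
  refine ⟨hx.1, le_trans (le_of_eq ?_) hx.2⟩
  refine Finset.sum_equiv (Equiv.swap c k) (fun a => ?_) fun a _ => ?_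
  · simp only [Finset.mem_erase, Finset.mem_univ, and_true, ne_eq]
    rw [Equiv.swap_apply_eq_iff, Equiv.swap_apply_of_ne_of_ne hc.symm hk.symm]
  · rw [toEuclideanLin_signedSwap]
    split_ifs
    · ring
    · linear_combination x (Equiv.swap c k a) ^ 2 * hσ

theorem image_signedSwap_soc (hc : c ≠ 0) (hc' : c ≠ ⟨1, h⟩) (hk : k ≠ 0)
    (hk' : k ≠ ⟨1, h⟩) (hσ : σ ^ 2 = 1) :
    Matrix.toEuclideanLin (signedSwap h c k σ) '' (soc d : Set (EuclideanSpace ℝ (Fin d))) =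
      soc d := by
  refine Subset.antisymm ?_ fun x hx => ?_
  · rintro _ ⟨x, hx, rfl⟩
    exact toEuclideanLin_signedSwap_mem_soc hc hk hσ hx
  · exact ⟨_, toEuclideanLin_signedSwap_mem_soc hc hk hσ hx,
      toEuclideanLin_signedSwap_signedSwap hc hc' hk hk' hσ x⟩

theorem toEuclideanLin_signedSwap_boundaryPoint (hc : c ≠ 0) (hc' : c ≠ ⟨1, h⟩) (hk : k ≠ 0)
    (hk' : k ≠ ⟨1, h⟩) :
    Matrix.toEuclideanLin (signedSwap h c k σ) (boundaryPoint h) = boundaryPoint h := by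
  ext a
  by_cases ha : a = 0 ∨ a = ⟨1, h⟩
  · rcases ha with rfl | rfl
    · exact toEuclideanLin_signedSwap_zero hc hk _
    · exact toEuclideanLin_signedSwap_one hc' hk' _
  · have hs := mt (swap_eq_zero_or_one_iff hc hc' hk hk' a).1 ha
    rw [not_or] at ha hs
    rw [toEuclideanLin_signedSwap, boundaryPoint_apply h ha.1 ha.2,
      boundaryPoint_apply h hs.1 hs.2, mul_zero]

end SignedSwap

/-! ### Normalizing a bad direction to a certificate -/

section Certificate

variable {t : ℕ} {m : Fin t → ℕ} [∀ i, NeZero (m i)] {z v : EuclideanSpace ℝ (Σ i, Fin (m i))}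

/-- A linear map which is the identity in every block but `j`, where it is a signed swap, is
admissible. -/
theorem isAdmissible_update_signedSwap {j : Fin t} (hj : j ∈ indexR z) {h : 2 ≤ m j}
    {c k : Fin (m j)} {σ : ℝ} (hc : c ≠ 0) (hc' : c ≠ ⟨1, h⟩) (hk : k ≠ 0) (hk' : k ≠ ⟨1, h⟩)
    (hσ : σ ^ 2 = 1) :
    IsAdmissible (Function.update (fun _ => 1) j (signedSwap h c k σ)) z where
  symm i := by
    rcases eq_or_ne i j with rfl | hi
    · rw [Function.update_self]
      exact isSymm_signedSwap hc hc' hk hk'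
    · rw [Function.update_of_ne hi]
      exact Matrix.isSymm_one
  image_cone i := by
    rcases eq_or_ne i j with rfl | hi
    · rw [Function.update_self]
      exact image_signedSwap_soc hc hc' hk hk' hσ
    · rw [Function.update_of_ne hi, Matrix.toLpLin_one]
      exact image_id _
  fix_slack := by
    refine ext_block fun i => ?_
    rw [block_toEuclideanLin_blockDiagonal']
    rcases eq_or_ne i j with rfl | hi
    · rw [Function.update_self]
      obtain ⟨_, hi⟩ := hj
      rw [hi]
      exact toEuclideanLin_signedSwap_boundaryPoint hc hc' hk hk'
    · rw [Function.update_of_ne hi, Matrix.toLpLin_one]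
      rfl

/-- After an admissible transformation, a tangent direction which is not feasible can be scaled to
a certificate. -/
theorem IsNormalized.exists_isCertificate (hz : IsNormalized z)
    (hv : v ∈ tangentDir (socProd m) z) (hv' : v ∉ feasibleDir (socProd m) z) :
    ∃ T : (∀ i, Matrix (Fin (m i)) (Fin (m i)) ℝ), IsAdmissible T z ∧ ∃ a : ℝ,
      IsCertificate z (a • Matrix.toEuclideanLin (Matrix.blockDiagonal' T) v) := by
  have hbad : ∃ j ∈ indexR z, ∃ h : 2 ≤ m j, block v j ⟨1, h⟩ = block v j 0 ∧
      tailSq h (block v j) ≠ 0 := by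
    by_contra! hcon
    exact hv' (hz.mem_feasibleDir hv hcon)
  obtain ⟨hO, hR⟩ := hz.mem_tangentDir_iff.1 hv
  obtain ⟨j, hj, h, heq, htail⟩ := hbad
  rw [Ne, tailSq_eq_zero_iff] at htail
  push Not at htail
  obtain ⟨k, hk, hk', hvk⟩ := htail
  have h3 : 3 ≤ m j := by
    by_contra hlt
    have h0 : (k : ℕ) ≠ 0 := fun h0 => hk (Fin.ext h0)
    have h1 : (k : ℕ) ≠ 1 := fun h1 => hk' (Fin.ext h1)
    have := k.2
    omega
  have hc : (⟨2, h3⟩ : Fin (m j)) ≠ 0 := fun h' => by simpa using congrArg Fin.val h'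
  have hc' : (⟨2, h3⟩ : Fin (m j)) ≠ ⟨1, h⟩ := fun h' => by simpa using congrArg Fin.val h'
  -- The sign of the component is absorbed into the transformation, because the scalar `a` must be
  -- positive to preserve the cone conditions.
  set σ : ℝ := |block v j k| / block v j k with hσ
  have hσ2 : σ ^ 2 = 1 := by
    rw [hσ, div_pow, sq_abs, div_self (pow_ne_zero 2 hvk)]
  have habs : 0 < |block v j k| := abs_pos.2 hvk
  refine ⟨_, isAdmissible_update_signedSwap hj hc hc' hk hk' hσ2, |block v j k|⁻¹, ?_⟩
  set T : ∀ i, Matrix (Fin (m i)) (Fin (m i)) ℝ :=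
    Function.update (fun _ => 1) j (signedSwap h ⟨2, h3⟩ k σ) with hT
  have hblock : ∀ i, i ≠ j →
      block (Matrix.toEuclideanLin (Matrix.blockDiagonal' T) v) i = block v i := by
    intro i hi
    rw [block_toEuclideanLin_blockDiagonal', hT, Function.update_of_ne hi, Matrix.toLpLin_one]
    rfl
  have hblock' : block (Matrix.toEuclideanLin (Matrix.blockDiagonal' T) v) j =
      Matrix.toEuclideanLin (signedSwap h ⟨2, h3⟩ k σ) (block v j) := by
    rw [block_toEuclideanLin_blockDiagonal', hT, Function.update_self]
  refine ⟨fun i hi => ?_, fun i hi h2 => ?_, j, hj, h3, |block v j k|⁻¹ * block v j 0, ?_, ?_, ?_⟩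
  · have hij : i ≠ j := by
      rintro rfl
      obtain ⟨_, hj⟩ := hj
      have h0 := boundaryPoint_zero h
      rw [show boundaryPoint h = 0 from hj.symm.trans hi] at h0
      exact zero_ne_one h0
    rw [block_smul, hblock i hij]
    exact smul_mem_cone (by positivity) (hO i hi)
  · rw [block_smul, PiLp.smul_apply, PiLp.smul_apply, smul_eq_mul, smul_eq_mul]
    refine mul_le_mul_of_nonneg_left ?_ (by positivity)
    rcases eq_or_ne i j with rfl | hi'
    · rw [hblock', toEuclideanLin_signedSwap_zero hc hk, toEuclideanLin_signedSwap_one hc' hk']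
      exact hR i hi h2
    · rw [hblock i hi']
      exact hR i hi h2
  · rw [block_smul, PiLp.smul_apply, hblock', toEuclideanLin_signedSwap_zero hc hk, smul_eq_mul]
  · rw [block_smul, PiLp.smul_apply, hblock', toEuclideanLin_signedSwap_one hc' hk', smul_eq_mul,
      heq]
  · rw [block_smul, PiLp.smul_apply, hblock', toEuclideanLin_signedSwap, if_neg (not_or.2 ⟨hc, hc'⟩),
      Equiv.swap_apply_left, smul_eq_mul, hσ, div_mul_cancel₀ _ hvk, inv_mul_cancel₀ habs.ne']

end Certificate

end SOCP

/-! ### The characterization of badly behaved systems -/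

theorem theorem4p1 {t n : ℕ} (m : Fin t → ℕ) [∀ i, NeZero (m i)]
    (A : Matrix (Σ i, Fin (m i)) (Fin n) ℝ)
    (b : EuclideanSpace ℝ (Σ i, Fin (m i)))
    (z : EuclideanSpace ℝ (Σ i, Fin (m i)))
    (hz : ConicSystem.IsMaximumSlack (Matrix.toEuclideanLin A) b (SOCP.socProd m) z)
    (hnorm : SOCP.IsNormalized z) :
    ConicSystem.BadlyBehaved (Matrix.toEuclideanLin A) b (SOCP.socProd m) ↔
      ∃ T : (∀ i, Matrix (Fin (m i)) (Fin (m i)) ℝ), SOCP.IsAdmissible T z ∧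
        ∃ v ∈ SOCP.columnSpan (Matrix.blockDiagonal' T * A)
            (Matrix.toEuclideanLin (Matrix.blockDiagonal' T) b),
          SOCP.IsCertificate z v := by
  rw [SOCP.badlyBehaved_iff_exists_mem_tangentDir hz hnorm]
  constructor
  · rintro ⟨x, hx, hx'⟩
    obtain ⟨T, hT, a, hcert⟩ := hnorm.exists_isCertificate hx hx'
    -- The bad direction already lies in the range of `A`, so `b` gets coefficient `0`.
    refine ⟨T, hT, _, SOCP.mem_columnSpan.2 ⟨0, a • x, ?_⟩, hcert⟩
    rw [SOCP.toEuclideanLin_mul_apply, map_smul, map_smul, zero_smul, add_zero]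
  · rintro ⟨T, hT, v, hv, hcert⟩
    obtain ⟨l, x, rfl⟩ := SOCP.mem_columnSpan.1 hv
    obtain ⟨htan, hfeas⟩ := hnorm.not_mem_feasibleDir_of_isCertificate hcert
    rw [SOCP.toEuclideanLin_mul_apply, ← map_smul, ← map_add] at htan hfeas
    have htan' := hT.mem_tangentDir_of_map_mem htan
    have hfeas' := mt hT.map_mem_feasibleDir hfeas
    obtain ⟨⟨x₀, hx₀⟩, hzK⟩ := hz.mem
    -- Since `b = z + A x₀`, the column combination is a vector in the range of `A` up to a multiple
    -- of `z`.
    have heq : Matrix.toEuclideanLin A x + l • b =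
        Matrix.toEuclideanLin A (x + l • x₀) + l • z := by
      rw [hx₀, map_add, map_smul, smul_sub]
      abel
    rw [heq] at htan' hfeas'
    rw [ConicSystem.add_smul_self_mem_tangentDir_iff] at htan'
    rw [ConicSystem.add_smul_self_mem_feasibleDir_iff hzK] at hfeas'
    exact ⟨_, htan', hfeas'⟩
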